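/- Let $F\colon \mathbf{Set}\to\mathbf{Set}$ be a finitary functor (i.e. one preserving filtered colimits) with $F\emptyset\neq\emptyset$. Then $F$ has an initial algebra $\iota\colon F(\mu F)\to\mu F$ and a terminal coalgebra $\tau\colon \nu F\to F(\nu F)$; both $\iota$ and $\tau$ are bijections. Let $F^\omega 1=\lim_{n<\omega}F^n1$ be the limit of the sequence $1\leftarrow F1\leftarrow FF1\leftarrow\cdots$ (whose maps are $v_{1,0}=\,!\colon F1\to1$ and $v_{n+2,n+1}=Fv_{n+1,n}$), with the metric in which distinct points $x,y$ have distance $2^{-n}$ for the least $n$ such that the projections of $x$ and $y$ to $F^n1$ differ. Let $c\colon\nu F\to F^\omega1$ be the canonical map, with components $c_0=\,!$ and $c_{n+1}=Fc_n\cdot\tau$, and let $m\colon\mu F\to\nu F$ be the unique coalgebra homomorphism from $(\mu F,\iota^{-1})$ to $(\nu F,\tau)$. Then: 1. $c$ and $m$ are injective, so that $\nu F$ becomes a metric subspace of $F^\omega 1$ via $c$, and $\mu F$ a metric subspace of $\nu F$ via $m$; all these metrics are ultrametrics. 2. The Cauchy completions of $\mu F$ and $\nu F$ coincide, namely with $F^\omega1$: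 the space $F^\omega 1$ is complete, and the isometric embeddings $c$ and $c\cdot m$ have dense images. 3. Let $F(\nu F)$ and $F(\mu F)$ carry the metrics transported from $\nu F$ and $\mu F$ along $\tau$ and $\iota$. Then $Fm\colon F(\mu F)\to F(\nu F)$ is an isometric embedding, $\iota^{-1}$ is continuous, and $\tau$ is the unique continuous extension of $\iota^{-1}$, i.e. the unique continuous map $g\colon\nu F\to F(\nu F)$ with $g\cdot m=Fm\cdot\iota^{-1}$. -/

import Mathlib

open CategoryTheory CategoryTheory.Limits CategoryTheory.Endofunctor

universe u

namespace SetFunctor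

/-- The objects `Fⁿ 1` (`n < ω`) of the terminal-coalgebra chain. -/
def chainObj (F : Type u ⥤ Type u) : ℕ → Type u
  | 0 => PUnit.{u + 1}
  | n + 1 => F.obj (chainObj F n)

/-- The connecting maps `v_{n+1,n} : Fⁿ⁺¹ 1 ⟶ Fⁿ 1`, with `v_{1,0}` the unique map to `1` and
`v_{n+2,n+1} = F v_{n+1,n}`. -/
def chainMap (F : Type u ⥤ Type u) : ∀ n, chainObj F (n + 1) ⟶ chainObj F n
  | 0 => ↾(fun _ => PUnit.unit)
  | n + 1 => F.map (chainMap F n)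

/-- `F^ω 1`, the limit of the sequence `1 ← F 1 ← F (F 1) ← ⋯`, as the set of compatible
sequences. -/
def OmegaLimit (F : Type u ⥤ Type u) : Type u :=
  {x : ∀ n, chainObj F n // ∀ n, chainMap F n (x (n + 1)) = x n}

/-- The ultrametric of `F^ω 1`: two distinct points have distance `(1/2)ⁿ`, where `n` is the first
index such that the projection to `Fⁿ 1` separates them. -/
noncomputable instance (F : Type u ⥤ Type u) : MetricSpace (OmegaLimit F) where
  dist x y := PiNat.dist.dist x.1 y.1
  dist_self x := PiNat.dist_self x.1
  dist_comm x y := PiNat.dist_comm x.1 y.1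
  dist_triangle x y z := PiNat.dist_triangle x.1 y.1 z.1
  eq_of_dist_eq_zero {x y} h := Subtype.ext (PiNat.eq_of_dist_eq_zero x.1 y.1 h)

/-- The canonical cone of a coalgebra `(V, τ)` over the sequence `Fⁿ 1`: the map `V ⟶ 1`, followed
recursively by `V ⟶ F V ⟶ F (Fⁿ 1)`. -/
def cone {F : Type u ⥤ Type u} (V : Coalgebra F) : ∀ n, V.V ⟶ chainObj F n
  | 0 => ↾(fun _ => PUnit.unit)
  | n + 1 => V.str ≫ F.map (cone V n)

theorem cone_comp {F : Type u ⥤ Type u} (V : Coalgebra F) (n : ℕ) :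
    cone V (n + 1) ≫ chainMap F n = cone V n := by
  induction n with
  | zero => rfl
  | succ n ih =>
    change (V.str ≫ F.map (cone V (n + 1))) ≫ F.map (chainMap F n) = V.str ≫ F.map (cone V n)
    rw [Category.assoc, ← F.map_comp, ih]

/-- The canonical map of a coalgebra into `F^ω 1`. -/
def toOmega {F : Type u ⥤ Type u} (V : Coalgebra F) (x : V.V) : OmegaLimit F :=
  ⟨fun n => cone V n x, fun n => ConcreteCategory.congr_hom (cone_comp V n) x⟩

/-- The inverse `ι⁻¹` of the structure map of an initial algebra, as a coalgebra on `μF`. -/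
def invCoalgebra {F : Type u ⥤ Type u} {A : Algebra F} (hA : IsInitial A) : Coalgebra F :=
  ⟨A.a, Algebra.Initial.strInv hA⟩

/-- The canonical map `m : μF ⟶ νF`: the unique coalgebra homomorphism from `(μF, ι⁻¹)` to the
terminal coalgebra. -/
def inclusion {F : Type u ⥤ Type u} {A : Algebra F} (hA : IsInitial A)
    {N : Coalgebra F} (hN : IsTerminal N) : A.a ⟶ N.V :=
  (hN.from (invCoalgebra hA)).f

theorem initial_str_injective {F : Type u ⥤ Type u} {A : Algebra F} (hA : IsInitial A) :
    Function.Injective A.str :=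
  Function.LeftInverse.injective (g := Algebra.Initial.strInv hA) fun x =>
    ConcreteCategory.congr_hom (Algebra.Initial.right_inv hA) x

theorem terminal_strInv_injective {F : Type u ⥤ Type u} {N : Coalgebra F} (hN : IsTerminal N) :
    Function.Injective (Coalgebra.Terminal.strInv hN) :=
  Function.LeftInverse.injective (g := N.str) fun x =>
    ConcreteCategory.congr_hom (Coalgebra.Terminal.left_inv hN) x

/-- `νF` as a metric subspace of `F^ω 1`, for a terminal coalgebra that embeds into it. -/
noncomputable abbrev nuMetric {F : Type u ⥤ Type u} {N : Coalgebra F}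
    (h : Function.Injective (toOmega N)) : MetricSpace N.V :=
  MetricSpace.induced (toOmega N) h inferInstance

/-- `μF` as a metric subspace of `νF` via `m`. -/
noncomputable abbrev muMetric {F : Type u ⥤ Type u} {A : Algebra F} (hA : IsInitial A)
    {N : Coalgebra F} (hN : IsTerminal N) (h : Function.Injective (toOmega N))
    (hm : Function.Injective (inclusion hA hN)) : MetricSpace A.a :=
  MetricSpace.induced (inclusion hA hN) hm (nuMetric h)

/-- The metric of `F(νF)`, transported from `νF` along the bijection `τ`. -/
noncomputable abbrev mapNuMetric {F : Type u ⥤ Type u}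
    {N : Coalgebra F} (hN : IsTerminal N) (h : Function.Injective (toOmega N)) :
    MetricSpace (F.obj N.V) :=
  MetricSpace.induced (Coalgebra.Terminal.strInv hN) (terminal_strInv_injective hN) (nuMetric h)

/-- The metric of `F(μF)`, transported from `μF` along the bijection `ι`. -/
noncomputable abbrev mapMuMetric {F : Type u ⥤ Type u} {A : Algebra F} (hA : IsInitial A)
    {N : Coalgebra F} (hN : IsTerminal N) (h : Function.Injective (toOmega N))
    (hm : Function.Injective (inclusion hA hN)) : MetricSpace (F.obj A.a) :=
  MetricSpace.induced A.str (initial_str_injective hA) (muMetric hA hN h hm)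

/-- `i : X → Y` exhibits the metric space `Y` as the Cauchy completion of `X`. -/
structure IsCauchyCompletion {X Y : Type*} [MetricSpace X] [MetricSpace Y] (i : X → Y) :
    Prop where
  complete : CompleteSpace Y
  isometry : Isometry i
  dense : DenseRange i

end SetFunctor

namespace SetFunctor

/-!
An element of `F X` depends on finitely many points of `X` only. So if maps `fₙ` eventually agree
with `g` at each point of `X`, then the `F fₙ` eventually agree with `F g` at each point of `F X`;
and if the `fₙ` eventually separate any two points of `X`, then the `F fₙ` jointly separate the
points of `F X`.

The points of `F^ω 1` arising as behaviours `toOmega C x` therefore carry a unique coalgebra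
structure compatible with the projections, and it is terminal; hence `toOmega` is injective on
`νF`.

A point of an algebra `(A, α)` induces maps `Fⁿ 1 ⟶ A`. Composing them with the projections of
`B = μF`, or of any subalgebra `B` of `(νF, τ⁻¹)`, to `Fⁿ 1` gives maps `qₙ : B ⟶ A` with
`qₙ₊₁ ∘ β = α ∘ F qₙ`, where `β` is the structure of `B`. If `B` has no proper subalgebras, these
stabilize pointwise to a homomorphism. Hence the least subalgebra of `(νF, τ⁻¹)` is initial, and
for `A = B = μF` every point is recovered from its projections, so that `μF` embeds into `F^ω 1`.
In the opposite order, `Fⁿ 1 ⟶ μF ⟶ Fⁿ 1` is the identity, so `μF` meets every ball of `F^ω 1`.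
-/

open Filter Topology

universe v

section Finitary

variable (F : Type u ⥤ Type v) [PreservesFilteredColimitsOfSize.{u, u} F]

theorem exists_finite_forall_map_eq {X : Type u} (t : F.obj X) :
    ∃ S : Set X, S.Finite ∧
      ∀ {Y : Type u} (f g : X ⟶ Y), Set.EqOn f g S → F.map f t = F.map g t := by
  have := HasCardinalLT.Set.isFiltered_of_aleph0_le X Cardinal.aleph0 le_rfl
  obtain ⟨S, s, rfl⟩ := Types.jointly_surjective_of_isColimit
    (isColimitOfPreserves F (HasCardinalLT.Set.isColimitCocone X Cardinal.aleph0 le_rfl)) t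
  refine ⟨S.1, hasCardinalLT_aleph0_iff _ |>.1 S.2, fun f g hfg => ?_⟩
  have hcomp : (HasCardinalLT.Set.cocone X _).ι.app S ≫ f =
      (HasCardinalLT.Set.cocone X _).ι.app S ≫ g := by
    ext x
    exact hfg x.2
  exact (Functor.map_comp_apply F _ f s).symm.trans
    ((congrArg (F.map · s) hcomp).trans (Functor.map_comp_apply F _ g s))

variable {F} {X : Type u} {ι : Type*} {l : Filter ι}

theorem eventually_map_eq {Y : Type u} {f : ι → (X ⟶ Y)} {g : X ⟶ Y}
    (h : ∀ x, ∀ᶠ i in l, f i x = g x) (t : F.obj X) :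
    ∀ᶠ i in l, F.map (f i) t = F.map g t := by
  obtain ⟨S, hS, hSt⟩ := exists_finite_forall_map_eq F t
  filter_upwards [(eventually_all_finite hS).2 fun x _ => h x] with i hi
  exact hSt _ _ hi

theorem eq_of_forall_map_eq [Nonempty X] [l.NeBot] {Y : ι → Type u} {f : ∀ i, X ⟶ Y i}
    (hf : ∀ x y, x ≠ y → ∀ᶠ i in l, f i x ≠ f i y) {s t : F.obj X}
    (h : ∀ i, F.map (f i) s = F.map (f i) t) : s = t := by
  obtain ⟨S, hS, hSs⟩ := exists_finite_forall_map_eq F s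
  obtain ⟨T, hT, hTt⟩ := exists_finite_forall_map_eq F t
  have hinj : ∀ᶠ i in l, Set.InjOn (f i) (S ∪ T) := by
    refine (eventually_all_finite (hS.union hT)).2 fun x _ =>
      (eventually_all_finite (hS.union hT)).2 fun y _ => ?_
    by_cases hxy : x = y
    · exact Eventually.of_forall fun _ _ => hxy
    · exact (hf x y hxy).mono fun _ hne heq => (hne heq).elim
  obtain ⟨i, hi⟩ := hinj.exists
  let r : Y i ⟶ X := ↾(Function.invFunOn (f i) (S ∪ T))
  have hr : Set.EqOn (f i ≫ r) (𝟙 X) (S ∪ T) := hi.leftInvOn_invFunOn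
  calc
    s = F.map (f i ≫ r) s := by
      rw [hSs _ _ (hr.mono Set.subset_union_left), Functor.map_id_apply]
    _ = F.map (f i ≫ r) t := by rw [Functor.map_comp_apply, h, ← Functor.map_comp_apply]
    _ = t := by rw [hTt _ _ (hr.mono Set.subset_union_right), Functor.map_id_apply]

end Finitary

section OmegaLimit

variable {F : Type u ⥤ Type u}

theorem OmegaLimit.apply_eq_of_le {x y : OmegaLimit F} {m n : ℕ} (hmn : m ≤ n)
    (h : x.1 n = y.1 n) : x.1 m = y.1 m := by
  induction n, hmn using Nat.le_induction with
  | base => exact h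
  | succ n _ ih => exact ih (by rw [← x.2, ← y.2, h])

theorem OmegaLimit.eventually_apply_ne {x y : OmegaLimit F} (h : x ≠ y) :
    ∀ᶠ n in atTop, x.1 n ≠ y.1 n := by
  obtain ⟨m, hm⟩ := Function.ne_iff.1 (Subtype.coe_ne_coe.2 h)
  filter_upwards [eventually_ge_atTop m] with n hmn
  exact mt (OmegaLimit.apply_eq_of_le hmn) hm

theorem OmegaLimit.dist_le_of_apply_eq {x y : OmegaLimit F} {n : ℕ} (h : x.1 n = y.1 n) :
    dist x y ≤ (1 / 2) ^ n :=
  PiNat.mem_cylinder_iff_dist_le.1 fun _ hi => OmegaLimit.apply_eq_of_le hi.le h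

instance : IsUltrametricDist (OmegaLimit F) :=
  ⟨fun x y z => PiNat.dist_triangle_nonarch x.1 y.1 z.1⟩

instance : CompleteSpace (OmegaLimit F) := by
  let _ (n : ℕ) : TopologicalSpace (chainObj F n) := ⊥
  have (n : ℕ) : DiscreteTopology (chainObj F n) := ⟨rfl⟩
  let _ : MetricSpace (∀ n, chainObj F n) := PiNat.metricSpace
  have : CompleteSpace (∀ n, chainObj F n) := PiNat.completeSpace
  let val (x : OmegaLimit F) : ∀ n, chainObj F n := x.1
  have hval : Isometry val := Isometry.of_dist_eq fun _ _ => rfl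
  have hclosed : IsClosed {x : ∀ n, chainObj F n | ∀ n, chainMap F n (x (n + 1)) = x n} := by
    simp only [Set.ofPred_forall]
    exact isClosed_iInter fun n => isClosed_eq
      (continuous_of_discreteTopology.comp (continuous_apply (n + 1))) (continuous_apply n)
  rw [completeSpace_iff_isComplete_range hval.isUniformInducing]
  exact Subtype.range_coe ▸ hclosed.isComplete

theorem OmegaLimit.denseRange_of_forall_exists_apply_eq {X : Type*} {f : X → OmegaLimit F}
    (h : ∀ (z : OmegaLimit F) (n : ℕ), ∃ x, (f x).1 n = z.1 n) : DenseRange f := by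
  intro z
  refine Metric.mem_closure_range_iff.2 fun ε hε => ?_
  obtain ⟨n, hn⟩ := exists_pow_lt_of_lt_one hε (one_half_lt_one (α := ℝ))
  obtain ⟨x, hx⟩ := h z n
  exact ⟨x, (OmegaLimit.dist_le_of_apply_eq hx.symm).trans_lt hn⟩

end OmegaLimit

section Behaviour

variable {F : Type u ⥤ Type u}

theorem hom_comp_cone {C D : Coalgebra F} (f : C ⟶ D) (n : ℕ) : f.f ≫ cone D n = cone C n := by
  induction n with
  | zero => rfl
  | succ n ih =>
    change f.f ≫ D.str ≫ F.map (cone D n) = C.str ≫ F.map (cone C n)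
    rw [← ih, F.map_comp, Coalgebra.Hom.h_assoc]

theorem toOmega_hom {C D : Coalgebra F} (f : C ⟶ D) (x : C.V) :
    toOmega D (f.f x) = toOmega C x :=
  Subtype.ext (funext fun n => ConcreteCategory.congr_hom (hom_comp_cone f n) x)

variable (F) in
/-- The behaviours of states of coalgebras, as points of `F^ω 1`: the carrier of the terminal
coalgebra. -/
def Behaviour : Type u :=
  {z : OmegaLimit F // ∃ (C : Coalgebra F) (x : C.V), toOmega C x = z}

/-- The projection of a behaviour to `Fⁿ 1`. -/
def Behaviour.proj (n : ℕ) : Behaviour F ⟶ chainObj F n := ↾(fun z => z.1.1 n)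

/-- The map sending a state of a coalgebra to its behaviour. -/
def Behaviour.of (C : Coalgebra F) : C.V ⟶ Behaviour F := ↾(fun x => ⟨toOmega C x, C, x, rfl⟩)

theorem Behaviour.of_comp_proj (C : Coalgebra F) (n : ℕ) :
    Behaviour.of C ≫ Behaviour.proj n = cone C n := rfl

theorem Behaviour.exists_map_proj_eq (z : Behaviour F) :
    ∃ t : F.obj (Behaviour F), ∀ n, F.map (Behaviour.proj n) t = Behaviour.proj (n + 1) z := by
  obtain ⟨_, C, x, rfl⟩ := z
  refine ⟨F.map (Behaviour.of C) (C.str x), fun n => ?_⟩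
  rw [← Functor.map_comp_apply, Behaviour.of_comp_proj]
  rfl

variable (F) in
/-- The coalgebra of all behaviours; its structure is chosen compatibly with the projections, which
for a finitary functor determines it. -/
noncomputable def behaviourCoalgebra : Coalgebra F where
  V := Behaviour F
  str := ↾(fun z => (Behaviour.exists_map_proj_eq z).choose)

theorem behaviourCoalgebra_str_comp_map_proj (n : ℕ) :
    (behaviourCoalgebra F).str ≫ F.map (Behaviour.proj n) = Behaviour.proj (n + 1) := by
  ext z
  exact (Behaviour.exists_map_proj_eq z).choose_spec n

theorem cone_behaviourCoalgebra (n : ℕ) :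
    cone (behaviourCoalgebra F) n = Behaviour.proj n := by
  induction n with
  | zero => rfl
  | succ n ih =>
    rw [← behaviourCoalgebra_str_comp_map_proj, ← ih]
    rfl

theorem toOmega_behaviourCoalgebra (z : Behaviour F) :
    toOmega (behaviourCoalgebra F) z = z.1 :=
  Subtype.ext (funext fun n => ConcreteCategory.congr_hom (cone_behaviourCoalgebra n) z)

variable [PreservesFilteredColimits F]

/-- The homomorphism sending a state of a coalgebra to its behaviour. -/
noncomputable def behaviourHom (C : Coalgebra F) : C ⟶ behaviourCoalgebra F where
  f := Behaviour.of C
  h := by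
    ext x
    have : Nonempty (Behaviour F) := ⟨Behaviour.of C x⟩
    refine eq_of_forall_map_eq (l := atTop) (f := Behaviour.proj)
      (fun y z hyz => OmegaLimit.eventually_apply_ne (Subtype.coe_ne_coe.2 hyz)) fun n => ?_
    refine (Functor.map_comp_apply F _ _ _).symm.trans ?_
    rw [Behaviour.of_comp_proj]
    exact (ConcreteCategory.congr_hom (behaviourCoalgebra_str_comp_map_proj n)
      (Behaviour.of C x)).symm

variable (F) in
/-- The coalgebra of behaviours is terminal: homomorphisms preserve `toOmega`, which on behaviours
is the inclusion into `F^ω 1`. -/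
noncomputable def behaviourCoalgebraIsTerminal : IsTerminal (behaviourCoalgebra F) :=
  IsTerminal.ofUniqueHom behaviourHom fun C f => by
    apply Coalgebra.ext
    ext x
    exact Subtype.ext ((toOmega_behaviourCoalgebra _).symm.trans (toOmega_hom f x))

theorem toOmega_injective_of_isTerminal {N : Coalgebra F} (hN : IsTerminal N) :
    Function.Injective (toOmega N) := by
  have hsection : behaviourHom N ≫ hN.from (behaviourCoalgebra F) = 𝟙 N := hN.hom_ext _ _
  have hinv : Function.LeftInverse (hN.from (behaviourCoalgebra F)).f (behaviourHom N).f :=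
    ConcreteCategory.congr_hom (congrArg Coalgebra.Hom.f hsection)
  exact fun x y h => hinv.injective (Subtype.ext h)

end Behaviour

section MinimalAlgebra

variable {F : Type u ⥤ Type u} {A B : Algebra F}

/-- A subset of an algebra that is closed under the algebra structure. -/
def IsSubalgebra (A : Algebra F) (P : Set A.a) : Prop :=
  ∀ t : F.obj P, A.str (F.map (↾Subtype.val) t) ∈ P

namespace IsSubalgebra

/-- A subalgebra, as an algebra. -/
def algebra {P : Set A.a} (hP : IsSubalgebra A P) : Algebra F where
  a := P
  str := ↾(fun t => ⟨_, hP t⟩)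

/-- The inclusion of a subalgebra. -/
def incl {P : Set A.a} (hP : IsSubalgebra A P) : hP.algebra ⟶ A where
  f := ↾Subtype.val
  h := rfl

theorem str_map_mem {P : Set A.a} (hP : IsSubalgebra A P) {X : Type u} (f : X ⟶ A.a)
    (hf : ∀ x, f x ∈ P) (t : F.obj X) : A.str (F.map f t) ∈ P := by
  have h := hP (F.map (↾(fun x => ⟨f x, hf x⟩)) t)
  rwa [← Functor.map_comp_apply] at h

theorem iInter {ι : Sort*} {P : ι → Set A.a} (hP : ∀ i, IsSubalgebra A (P i)) :
    IsSubalgebra A (⋂ i, P i) := fun t =>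
  Set.mem_iInter.2 fun i => (hP i).str_map_mem _ (fun x => Set.mem_iInter.1 x.2 i) t

theorem equalizer (f g : A ⟶ B) : IsSubalgebra A {x | f.f x = g.f x} := by
  intro t
  have hfg : (↾Subtype.val : ({x | f.f x = g.f x} : Type u) ⟶ A.a) ≫ f.f = ↾Subtype.val ≫ g.f := by
    ext x
    exact x.2
  have hstr : F.map (↾Subtype.val : ({x | f.f x = g.f x} : Type u) ⟶ A.a) ≫ A.str ≫ f.f =
      F.map (↾Subtype.val) ≫ A.str ≫ g.f := by
    rw [← f.h, ← g.h, ← F.map_comp_assoc, hfg, F.map_comp_assoc]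
  exact ConcreteCategory.congr_hom hstr t

theorem image (f : A ⟶ B) {P : Set A.a} (hP : IsSubalgebra A P) : IsSubalgebra B (f.f '' P) := by
  intro t
  choose r hrP hr using fun y : f.f '' P => y.2
  have hcomp : (↾Subtype.val : (f.f '' P : Type u) ⟶ B.a) = ↾r ≫ f.f := by
    ext y
    exact (hr y).symm
  refine ⟨A.str (F.map (↾r) t), hP.str_map_mem _ hrP t, ?_⟩
  rw [hcomp, Functor.map_comp_apply]
  exact (ConcreteCategory.congr_hom f.h (F.map (↾r) t)).symm

end IsSubalgebra

/-- An algebra without proper subalgebras: one that admits proofs by structural induction. -/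
def IsMinimalAlgebra (A : Algebra F) : Prop :=
  ∀ P, IsSubalgebra A P → ∀ x, x ∈ P

theorem IsMinimalAlgebra.hom_ext (hA : IsMinimalAlgebra A) (f g : A ⟶ B) : f = g := by
  apply Algebra.ext
  ext x
  exact hA _ (IsSubalgebra.equalizer f g) x

theorem isMinimalAlgebra_of_isInitial (hA : IsInitial A) : IsMinimalAlgebra A := by
  intro P hP x
  have hsection : hA.to hP.algebra ≫ hP.incl = 𝟙 A := hA.hom_ext _ _
  have hx : hP.incl.f ((hA.to hP.algebra).f x) = x :=
    ConcreteCategory.congr_hom (congrArg Algebra.Hom.f hsection) x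
  exact hx ▸ Subtype.prop (p := (· ∈ P)) _

/-- The carrier of the least subalgebra, as the intersection of all subalgebras. -/
def leastSubalgebra (A : Algebra F) : Set A.a :=
  ⋂ P : {P // IsSubalgebra A P}, P.1

theorem isSubalgebra_leastSubalgebra (A : Algebra F) : IsSubalgebra A (leastSubalgebra A) :=
  IsSubalgebra.iInter fun P => P.2

theorem isMinimalAlgebra_leastSubalgebra (A : Algebra F) :
    IsMinimalAlgebra (isSubalgebra_leastSubalgebra A).algebra := by
  intro P hP x
  obtain ⟨y, hy, hyx⟩ := Set.mem_iInter.1 x.2 ⟨_, hP.image (isSubalgebra_leastSubalgebra A).incl⟩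
  exact Subtype.ext hyx ▸ hy

theorem IsMinimalAlgebra.exists_hom_eventually_eq [PreservesFilteredColimits F]
    (hB : IsMinimalAlgebra B) {q : ℕ → (B.a ⟶ A.a)}
    (hq : ∀ n, B.str ≫ q (n + 1) = F.map (q n) ≫ A.str) :
    ∃ h : B ⟶ A, ∀ b, ∀ᶠ n in atTop, q n b = h.f b := by
  have hstep {X : Type u} (i : X ⟶ B.a) (k : X ⟶ A.a) (hk : ∀ x, ∀ᶠ n in atTop, q n (i x) = k x)
      (t : F.obj X) : ∀ᶠ n in atTop, q n (B.str (F.map i t)) = A.str (F.map k t) := by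
    rw [← map_add_atTop_eq_nat 1, eventually_map]
    filter_upwards [eventually_map_eq (f := fun n => i ≫ q n) hk t] with n hn
    rw [← hn, Functor.map_comp_apply]
    exact ConcreteCategory.congr_hom (hq n) (F.map i t)
  have hconv : IsSubalgebra B {b | ∃ a, ∀ᶠ n in atTop, q n b = a} := fun t =>
    ⟨_, hstep (↾Subtype.val) (↾(fun b => b.2.choose)) (fun b => b.2.choose_spec) t⟩
  choose h hh using hB _ hconv
  refine ⟨⟨↾h, ?_⟩, hh⟩
  ext t
  obtain ⟨n, hn, hn'⟩ := ((hstep (𝟙 B.a) (↾h) hh t).and (hh (B.str t))).exists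
  rw [Functor.map_id_apply] at hn
  exact hn.symm.trans hn'

end MinimalAlgebra

section Approximation

variable {F : Type u ⥤ Type u}

/-- The maps `Fⁿ 1 ⟶ A` induced by a point of an algebra, regarded as a map `1 ⟶ A`. -/
def approx (A : Algebra F) (a₀ : A.a) : ∀ n, chainObj F n ⟶ A.a
  | 0 => ↾(fun _ => a₀)
  | n + 1 => F.map (approx A a₀ n) ≫ A.str

variable {A B : Algebra F} {C : Coalgebra F} {i : B.a ⟶ C.V}

-- For invertible `B.str`, the hypothesis `hi` says that `i` is a coalgebra homomorphism from
-- `(B, B.str⁻¹)`.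
theorem str_comp_cone_comp_approx (hi : B.str ≫ i ≫ C.str = F.map i) (a₀ : A.a) (n : ℕ) :
    B.str ≫ i ≫ cone C (n + 1) ≫ approx A a₀ (n + 1) =
      F.map (i ≫ cone C n ≫ approx A a₀ n) ≫ A.str := by
  change B.str ≫ i ≫ (C.str ≫ F.map (cone C n)) ≫ F.map (approx A a₀ n) ≫ A.str = _
  simp only [Functor.map_comp, Category.assoc, ← hi]

theorem approx_comp_cone (hi : B.str ≫ i ≫ C.str = F.map i) (b₀ : B.a) (n : ℕ) :
    approx B b₀ n ≫ i ≫ cone C n = 𝟙 (chainObj F n) := by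
  induction n with
  | zero => rfl
  | succ n ih =>
    calc
      (F.map (approx B b₀ n) ≫ B.str) ≫ i ≫ C.str ≫ F.map (cone C n)
          = F.map (approx B b₀ n ≫ i ≫ cone C n) := by
        simp only [Functor.map_comp, Category.assoc, ← hi]
      _ = 𝟙 (F.obj (chainObj F n)) := by rw [ih, F.map_id]

theorem denseRange_toOmega_comp [Nonempty B.a] (hi : B.str ≫ i ≫ C.str = F.map i) :
    DenseRange (toOmega C ∘ i) :=
  let ⟨b₀⟩ := ‹Nonempty B.a›
  OmegaLimit.denseRange_of_forall_exists_apply_eq fun z n =>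
    ⟨approx B b₀ n (z.1 n), ConcreteCategory.congr_hom (approx_comp_cone hi b₀ n) (z.1 n)⟩

namespace IsMinimalAlgebra

variable [PreservesFilteredColimits F]

theorem exists_hom_eventually_approx_eq (hB : IsMinimalAlgebra B)
    (hi : B.str ≫ i ≫ C.str = F.map i) (a₀ : A.a) :
    ∃ h : B ⟶ A, ∀ b, ∀ᶠ n in atTop, approx A a₀ n (cone C n (i b)) = h.f b :=
  hB.exists_hom_eventually_eq (q := fun n => i ≫ cone C n ≫ approx A a₀ n)
    (str_comp_cone_comp_approx hi a₀)

theorem toOmega_comp_injective (hB : IsMinimalAlgebra B) (hi : B.str ≫ i ≫ C.str = F.map i) :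
    Function.Injective (toOmega C ∘ i) := by
  intro x y hxy
  obtain ⟨h, hh⟩ := hB.exists_hom_eventually_approx_eq (A := B) hi x
  rw [hB.hom_ext h (𝟙 B)] at hh
  obtain ⟨n, hx, hy⟩ := ((hh x).and (hh y)).exists
  have hn : cone C n (i x) = cone C n (i y) := congrFun (congrArg Subtype.val hxy) n
  exact hx.symm.trans ((congrArg (approx B x n) hn).trans hy)

end IsMinimalAlgebra

end Approximation

section Initial

variable {F : Type u ⥤ Type u}

theorem nonempty_algebra (hF : Nonempty (F.obj PEmpty.{u + 1})) (A : Algebra F) : Nonempty A.a :=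
  hF.map fun p => A.str (F.map (↾PEmpty.elim) p)

/-- The inverse `τ⁻¹` of the structure map of a terminal coalgebra, as an algebra on `νF`. -/
def invAlgebra {N : Coalgebra F} (hN : IsTerminal N) : Algebra F :=
  ⟨N.V, Coalgebra.Terminal.strInv hN⟩

theorem str_comp_incl_comp_str {N : Coalgebra F} (hN : IsTerminal N)
    {P : Set (invAlgebra hN).a} (hP : IsSubalgebra (invAlgebra hN) P) :
    hP.algebra.str ≫ hP.incl.f ≫ N.str = F.map hP.incl.f := by
  have hstr : (invAlgebra hN).str ≫ N.str = 𝟙 (F.obj N.V) := Coalgebra.Terminal.left_inv hN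
  exact (Algebra.Hom.h_assoc hP.incl N.str).symm.trans
    ((congrArg (F.map hP.incl.f ≫ ·) hstr).trans (Category.comp_id _))

theorem hasInitial_algebra [PreservesFilteredColimits F] (hF : Nonempty (F.obj PEmpty.{u + 1}))
    {N : Coalgebra F} (hN : IsTerminal N) : HasInitial (Algebra F) := by
  have hmin := isMinimalAlgebra_leastSubalgebra (invAlgebra hN)
  have hhom (A : Algebra F) :
      Nonempty ((isSubalgebra_leastSubalgebra (invAlgebra hN)).algebra ⟶ A) :=
    have ⟨a₀⟩ := nonempty_algebra hF A
    have ⟨h, _⟩ := hmin.exists_hom_eventually_approx_eq (str_comp_incl_comp_str hN _) a₀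
    ⟨h⟩
  exact (IsInitial.ofUniqueHom (fun A => (hhom A).some) fun _ _ => hmin.hom_ext _ _).hasInitial

variable {A : Algebra F} (hA : IsInitial A) {N : Coalgebra F} (hN : IsTerminal N)

theorem inclusion_comp_str :
    inclusion hA hN ≫ N.str = Algebra.Initial.strInv hA ≫ F.map (inclusion hA hN) :=
  (hN.from (invCoalgebra hA)).h.symm

theorem str_comp_inclusion_comp_str :
    A.str ≫ inclusion hA hN ≫ N.str = F.map (inclusion hA hN) := by
  rw [inclusion_comp_str, ← Category.assoc, Algebra.Initial.right_inv, Category.id_comp]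

theorem inclusion_injective [PreservesFilteredColimits F] :
    Function.Injective (inclusion hA hN) :=
  .of_comp ((isMinimalAlgebra_of_isInitial hA).toOmega_comp_injective
    (str_comp_inclusion_comp_str hA hN))

theorem initial_str_strInv : Function.RightInverse (Algebra.Initial.strInv hA) A.str :=
  ConcreteCategory.congr_hom (Algebra.Initial.left_inv hA)

theorem terminal_strInv_str : Function.RightInverse N.str (Coalgebra.Terminal.strInv hN) :=
  ConcreteCategory.congr_hom (Coalgebra.Terminal.right_inv hN)

end Initial

section Metric

variable {X Y Z : Type*}

theorem isUltrametricDist_of_isometry [PseudoMetricSpace X] [PseudoMetricSpace Y]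
    [IsUltrametricDist Y] {f : X → Y} (hf : Isometry f) : IsUltrametricDist X :=
  ⟨fun x y z => by simpa only [hf.dist_eq] using dist_triangle_max (f x) (f y) (f z)⟩

theorem denseRange_of_isInducing_comp [TopologicalSpace Y] [TopologicalSpace Z] {f : X → Y}
    {g : Y → Z} (hg : IsInducing g) (h : DenseRange (g ∘ f)) : DenseRange f :=
  hg.dense_iff.2 fun y => Set.range_comp g f ▸ h (g y)

end Metric

end SetFunctor

open SetFunctor in
theorem theoremT (F : Type u ⥤ Type u) [PreservesFilteredColimits F]
    (hF : Nonempty (F.obj PEmpty.{u + 1})) :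
    HasInitial (Algebra F) ∧ HasTerminal (Coalgebra F) ∧
    ∀ (A : Algebra F) (hA : IsInitial A) (N : Coalgebra F) (hN : IsTerminal N),
      ∃ (hν : Function.Injective (SetFunctor.toOmega N))
        (hμ : Function.Injective (SetFunctor.inclusion hA hN)),
        letI : MetricSpace N.V := SetFunctor.nuMetric hν
        letI : MetricSpace A.a := SetFunctor.muMetric hA hN hν hμ
        letI : MetricSpace (F.obj N.V) := SetFunctor.mapNuMetric hN hν
        letI : MetricSpace (F.obj A.a) := SetFunctor.mapMuMetric hA hN hν hμ
        IsUltrametricDist (SetFunctor.OmegaLimit F) ∧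
        IsUltrametricDist N.V ∧ IsUltrametricDist A.a ∧
        SetFunctor.IsCauchyCompletion (SetFunctor.toOmega N) ∧
        SetFunctor.IsCauchyCompletion
          (fun x : A.a => SetFunctor.toOmega N (SetFunctor.inclusion hA hN x)) ∧
        Isometry (F.map (SetFunctor.inclusion hA hN)) ∧
        Continuous (Algebra.Initial.strInv hA) ∧
        Continuous N.str ∧
        (∀ x : A.a, N.str (SetFunctor.inclusion hA hN x) =
          F.map (SetFunctor.inclusion hA hN) (Algebra.Initial.strInv hA x)) ∧
        ∀ g : N.V → F.obj N.V, Continuous g →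
          (∀ x : A.a, g (SetFunctor.inclusion hA hN x) =
            F.map (SetFunctor.inclusion hA hN) (Algebra.Initial.strInv hA x)) →
          ∀ y : N.V, g y = N.str y := by
  have hT := behaviourCoalgebraIsTerminal F
  refine ⟨hasInitial_algebra hF hT, hT.hasTerminal, fun A hA N hN => ?_⟩
  have hν := toOmega_injective_of_isTerminal hN
  have hμ := inclusion_injective hA hN
  refine ⟨hν, hμ, ?_⟩
  let _ : MetricSpace N.V := nuMetric hν
  let _ : MetricSpace A.a := muMetric hA hN hν hμ
  let _ : MetricSpace (F.obj N.V) := mapNuMetric hN hν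
  let _ : MetricSpace (F.obj A.a) := mapMuMetric hA hN hν hμ
  have hc : Isometry (toOmega N) := MetricSpace.isometry_induced _ hν
  have hm : Isometry (inclusion hA hN) := MetricSpace.isometry_induced _ hμ
  have hι : Isometry A.str := MetricSpace.isometry_induced _ (initial_str_injective hA)
  have hτ : Isometry N.str := (MetricSpace.isometry_induced _
    (terminal_strInv_injective hN)).right_inv (terminal_strInv_str hN)
  have hsquare := str_comp_inclusion_comp_str hA hN
  have hcomm := ConcreteCategory.congr_hom (inclusion_comp_str hA hN)
  have := nonempty_algebra hF A
  have hcm : DenseRange (toOmega N ∘ inclusion hA hN) := denseRange_toOmega_comp hsquare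
  have hmd := denseRange_of_isInducing_comp hc.isEmbedding.isInducing hcm
  exact ⟨inferInstance, isUltrametricDist_of_isometry hc,
    isUltrametricDist_of_isometry (hc.comp hm), ⟨inferInstance, hc, hcm.of_comp⟩,
    ⟨inferInstance, hc.comp hm, hcm⟩, hsquare ▸ hτ.comp (hm.comp hι),
    (hι.right_inv (initial_str_strInv hA)).continuous, hτ.continuous, hcomm, fun g hg hgm =>
      congrFun (hmd.equalizer hg hτ.continuous (funext fun x => (hgm x).trans (hcomm x).symm))⟩
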